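/- Let $p\ge 1$, let $(Y_1,Y_2,X_1,\dots,X_p)$ be a real random vector that has a joint density, and let $V_j=F_{Y_j}(Y_j)$, $U_i=F_{X_i}(X_i)$ be the probability integral transforms. Write $\mathbf U_{a:b}=(U_a,\dots,U_b)$ (empty if $a>b$), and similarly $\mathbf X_{a:b}$, $\mathbf x_{a:b}$. The Y-vine tree sequence on $V_1,V_2,U_1,\dots,U_p$ consists of trees $T_1,\dots,T_{p+1}$ whose edges are the following. $T_1$ has the edges $(V_j,U_1)$, $j=1,2$, and $(U_i,U_{i+1})$, $1\le i\le p-1$. For $2\le k\le p$, $T_k$ has the edges $(V_jU_{k-1};\mathbf U_{1:k-2}\,,\;U_1U_k;\mathbf U_{2:k-1})$, $j=1,2$, and $(U_iU_{i+k-1};\mathbf U_{i+1:i+k-2}\,,\;U_{i+1}U_{i+k};\mathbf U_{i+2:i+k-1})$, $1\le i\le p-k$. $T_{p+1}$ has the single edge $(V_1U_p;\mathbf U_{1:p-1}\,,\;V_2U_p;\mathbf U_{1:p-1})$. The conditioning set of an edge consists of the variables common to its two nodes, and its two conditioned variables are the remaining variable of the first node and that of the second. Thus the edges carry the labels $V_jU_i;\mathbf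 U_{1:i-1}$ ($j=1,2$, $1\le i\le p$), $U_iU_{i+k};\mathbf U_{i+1:i+k-1}$ ($1\le k\le p-1$, $1\le i\le p-k$) and $V_1V_2;\mathbf U_{1:p}$. Suppose that $(V_1,V_2,U_1,\dots,U_p)$ follows a (simplified) Y-vine copula with these trees: for each edge, with conditioned variables $A,B$ and conditioning variables $\mathbf D$, there is a bivariate copula density $c_{A,B;\mathbf D}$ on $[0,1]^2$, not depending on the value of $\mathbf D$, such that for almost every value $\mathbf d$ of $\mathbf D$ the copula of the conditional distribution of $(A,B)$ given $\mathbf D=\mathbf d$ has density $c_{A,B;\mathbf D}$. Let $f_{Y_j}$ be the density of $Y_j$, let $F_{Y_j|\mathbf X_{1:i-1}}$, $F_{X_i|\mathbf X_{1:i-1}}$ denote conditional distribution functions (unconditional ones for $i=1$), and let $f_{Y_j|\mathbf X}=f_{Y_j,\mathbf X}/f_{\mathbf X}$ and $f_{Y_k|\mathbf X,Y_j}=f_{Y_1,Y_2,\mathbf X}/f_{Y_j,\mathbf X}$ be the conditional densities, where the denominators are positive. Then the following hold for Lebesgue-almost all $(y_1,y_2,\mathbf x)$ with positive denominator. (a)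 For $j=1,2$, $$f_{Y_j|\mathbf X}(y_j|\mathbf x)=f_{Y_j}(y_j)\prod_{i=1}^p c_{V_j,U_i;\mathbf U_{1:i-1}}\bigl(F_{Y_j|\mathbf X_{1:i-1}}(y_j|\mathbf x_{1:i-1}),\,F_{X_i|\mathbf X_{1:i-1}}(x_i|\mathbf x_{1:i-1})\bigr).$$ (b) For $j,k\in\{1,2\}$ with $j\ne k$, $$f_{Y_k|\mathbf X,Y_j}(y_k|\mathbf x,y_j)=\prod_{i=1}^p c_{V_k,U_i;\mathbf U_{1:i-1}}\bigl(F_{Y_k|\mathbf X_{1:i-1}}(y_k|\mathbf x_{1:i-1}),\,F_{X_i|\mathbf X_{1:i-1}}(x_i|\mathbf x_{1:i-1})\bigr)\cdot c_{V_1,V_2;\mathbf U_{1:p}}\bigl(F_{Y_1|\mathbf X}(y_1|\mathbf x),\,F_{Y_2|\mathbf X}(y_2|\mathbf x)\bigr)\cdot f_{Y_k}(y_k).$$ -/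

import Mathlib

open MeasureTheory Set

namespace YVine

/-! ### The Y-vine tree sequence -/

/-- The variables of a Y-vine with `p` predictors: two responses and `p` predictors. -/
abbrev YVar (p : ℕ) : Type := Fin 2 ⊕ Fin p

/-- The responses `V₁, V₂` are `V 0, V 1`. -/
abbrev V {p : ℕ} (j : Fin 2) : YVar p := Sum.inl j

/-- The predictors `U₁, …, U_p` are `U 0, …, U (p - 1)`. -/
abbrev U {p : ℕ} (i : Fin p) : YVar p := Sum.inr i

/-- The set of predictors `U i`, `i ∈ S`. In particular `Us (Finset.Iio i)` is the set of all
predictors that come before `U i`, and `Us Finset.univ` the set of all predictors. -/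
def Us {p : ℕ} (S : Finset (Fin p)) : Finset (YVar p) := S.map Function.Embedding.inr

/-- A node of one of the trees: a conditioned set together with a conditioning set. -/
structure Node (p : ℕ) where
  conditioned : Finset (YVar p)
  conditioning : Finset (YVar p)

/-- All variables that occur in a node. -/
def Node.vars {p : ℕ} (a : Node p) : Finset (YVar p) := a.conditioned ∪ a.conditioning

/-- A node of the first tree: a single variable. -/
def varNode {p : ℕ} (v : YVar p) : Node p := ⟨{v}, ∅⟩

/-- The node `V_j U_m ; U_{1:m-1}`. -/
def respNode {p : ℕ} (j : Fin 2) (m : Fin p) : Node p := ⟨{V j, U m}, Us (Finset.Iio m)⟩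

/-- The node `U_i U_l ; U_{i+1:l-1}`. -/
def predNode {p : ℕ} (i l : Fin p) : Node p := ⟨{U i, U l}, Us (Finset.Ioo i l)⟩

/-- `IsEdge p k a b`: the pair `(a, b)` is an edge of the tree `T_k` of the Y-vine tree sequence,
`1 ≤ k ≤ p + 1` (the nodes of `T_k` are the endpoints of its edges). Predictors are numbered
from `0` here, so that `U_1, U_k, U_{k-1}` are those with index `0, k - 1, k - 2`. -/
inductive IsEdge (p : ℕ) : ℕ → Node p → Node p → Prop
  /-- `(V_j, U_1)` in `T_1`. -/
  | resp_first (j : Fin 2) (o : Fin p) (ho : o.val = 0) :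
      IsEdge p 1 (varNode (V j)) (varNode (U o))
  /-- `(U_i, U_{i+1})` in `T_1`. -/
  | pred_first (i i' : Fin p) (hi : i'.val = i.val + 1) :
      IsEdge p 1 (varNode (U i)) (varNode (U i'))
  /-- `(V_j U_{k-1}; U_{1:k-2} , U_1 U_k; U_{2:k-1})` in `T_k`, `2 ≤ k ≤ p`. -/
  | resp (k : ℕ) (j : Fin 2) (o m l : Fin p) (ho : o.val = 0) (hm : m.val + 2 = k)
      (hl : l.val + 1 = k) :
      IsEdge p k (respNode j m) (predNode o l)
  /-- `(U_i U_{i+k-1}; U_{i+1:i+k-2} , U_{i+1} U_{i+k}; U_{i+2:i+k-1})` in `T_k`, `2 ≤ k ≤ p`. -/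
  | pred (k : ℕ) (hk : 2 ≤ k) (i i' l l' : Fin p) (hi : i'.val = i.val + 1)
      (hl : l.val + 1 = i.val + k) (hl' : l'.val = l.val + 1) :
      IsEdge p k (predNode i l) (predNode i' l')
  /-- `(V_1 U_p; U_{1:p-1} , V_2 U_p; U_{1:p-1})` in `T_{p+1}`. -/
  | last (m : Fin p) (hm : m.val + 1 = p) :
      IsEdge p (p + 1) (respNode 0 m) (respNode 1 m)

/-- The edge between the nodes `a` and `b` has conditioned variables `x` (from `a`) and `y`
(from `b`) and conditioning set `D`. -/
structure IsEdgeLabel {p : ℕ} (a b : Node p) (x y : YVar p) (D : Finset (YVar p)) : Prop where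
  left : a.vars \ b.vars = {x}
  right : b.vars \ a.vars = {y}
  conditioning : a.vars ∩ b.vars = D

/-! ### Conditional distribution functions and densities -/

section Random

variable {Ω : Type*} [MeasurableSpace Ω] {ι : Type*}

/-- The subvector `Z_A` of a family of real random variables. -/
def subvec (Z : ι → Ω → ℝ) (A : Finset ι) : Ω → (A → ℝ) := fun ω a => Z a ω

/-- The conditional distribution function `F_{Z_x | Z_D}(s | t)`. For `D = ∅` it is the
distribution function of `Z_x`. -/
noncomputable def condDF (P : Measure Ω) [IsFiniteMeasure P] (Z : ι → Ω → ℝ) (x : ι)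
    (D : Finset ι) (s : ℝ) (t : D → ℝ) : ℝ :=
  (ProbabilityTheory.condDistrib (Z x) (subvec Z D) P t).real (Iic s)

/-- The joint conditional distribution function `F_{Z_x, Z_y | Z_D}(r, s | t)`. -/
noncomputable def condDF₂ (P : Measure Ω) [IsFiniteMeasure P] (Z : ι → Ω → ℝ) (x y : ι)
    (D : Finset ι) (r s : ℝ) (t : D → ℝ) : ℝ :=
  (ProbabilityTheory.condDistrib (fun ω => (Z x ω, Z y ω)) (subvec Z D) P t).real
    (Iic r ×ˢ Iic s)

/-- The (Lebesgue) density `f_{Z_A}(z_A)` of the subvector `Z_A`. -/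
noncomputable def density (P : Measure Ω) (Z : ι → Ω → ℝ) (A : Finset ι) (z : ι → ℝ) : ℝ :=
  (pdf (subvec Z A) P volume (fun a => z a)).toReal

/-- The conditional density `f_{Z_x | Z_D}(z_x | z_D) = f_{Z_x, Z_D}(z_x, z_D) / f_{Z_D}(z_D)`,
meaningful where `f_{Z_D}(z_D) > 0`. -/
noncomputable def condDensity [DecidableEq ι] (P : Measure Ω) (Z : ι → Ω → ℝ) (x : ι)
    (D : Finset ι) (z : ι → ℝ) : ℝ :=
  density P Z (insert x D) z / density P Z D z

/-- The probability integral transforms `F_{Z_v}(Z_v)`. -/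
noncomputable def pit (P : Measure Ω) (Z : ι → Ω → ℝ) : ι → Ω → ℝ :=
  fun v ω => ProbabilityTheory.cdf (P.map (Z v)) (Z v ω)

end Random

/-! ### Pair copulas and Y-vine copulas -/

/-- `c` is the density of a bivariate copula: a probability density on the unit square whose
margins are uniform. -/
structure IsCopulaDensity (c : ℝ × ℝ → ℝ) : Prop where
  measurable : Measurable c
  nonneg : ∀ z, 0 ≤ c z
  margin_left : ∀ u ∈ Icc (0 : ℝ) 1,
    ∫⁻ z in Icc 0 u ×ˢ Icc 0 1, ENNReal.ofReal (c z) = ENNReal.ofReal u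
  margin_right : ∀ v ∈ Icc (0 : ℝ) 1,
    ∫⁻ z in Icc 0 1 ×ˢ Icc 0 v, ENNReal.ofReal (c z) = ENNReal.ofReal v

/-- The copula `C(u, v)` with density `c`. -/
noncomputable def copulaDF (c : ℝ × ℝ → ℝ) (u v : ℝ) : ℝ :=
  ∫ z in Icc 0 u ×ˢ Icc 0 v, c z

/-- `c` is the density of the copula of `W_x` and `W_y` given `W_D`, and this copula does not
depend on the value of `W_D` (simplifying assumption): for almost every value `t` of `W_D`,
`F_{W_x, W_y | W_D}(r, s | t) = C(F_{W_x | W_D}(r | t), F_{W_y | W_D}(s | t))` for all `r, s`. -/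
structure IsPairCopula {Ω : Type*} [MeasurableSpace Ω] {ι : Type*} (P : Measure Ω)
    [IsFiniteMeasure P] (W : ι → Ω → ℝ) (x y : ι) (D : Finset ι) (c : ℝ × ℝ → ℝ) : Prop where
  isCopulaDensity : IsCopulaDensity c
  sklar : ∀ᵐ t ∂(P.map (subvec W D)), ∀ r s : ℝ,
    condDF₂ P W x y D r s t = copulaDF c (condDF P W x D r t) (condDF P W y D s t)

/-- The random vector `W = (V₁, V₂, U₁, …, U_p)` with uniform margins is distributed according to
the (simplified) Y-vine copula with pair copula densities `c x y D = c_{x, y; D}`: for each edge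
of each tree of the Y-vine tree sequence, with conditioned variables `x, y` and conditioning
set `D`, the function `c x y D` is the density of the copula of `W_x, W_y` given `W_D`. -/
structure IsYVineCopula {Ω : Type*} [MeasurableSpace Ω] {p : ℕ} (P : Measure Ω)
    [IsFiniteMeasure P] (W : YVar p → Ω → ℝ)
    (c : YVar p → YVar p → Finset (YVar p) → ℝ × ℝ → ℝ) : Prop where
  measurable : ∀ v, Measurable (W v)
  uniform : ∀ v, P.map (W v) = volume.restrict (Icc 0 1)
  pairCopula : ∀ k a b, IsEdge p k a b → ∀ x y D, IsEdgeLabel a b x y D →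
    IsPairCopula P W x y D (c x y D)

/-- The random vector `(Y₁, Y₂, X₁, …, X_p)`, indexed by the variables of the Y-vine. -/
def joint {Ω : Type*} {p : ℕ} (Y : Fin 2 → Ω → ℝ) (X : Fin p → Ω → ℝ) : YVar p → Ω → ℝ :=
  Sum.elim Y X

end YVine

/-! Everything follows from one identity for a pair copula of `x, y` given `D`. Sklar's theorem,
applied to the conditional law given `Z_D = z_D`, says `f(x, y | D) = c(F(x | D), F(y | D)) f(x | D)
f(y | D)`; multiplied by `f_D²` this is `f_{x,y,D} f_D = c · f_{x,D} f_{y,D}` wherever `f_D > 0`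
(`density_insert_insert_mul_density`). For the edge `V_j U_i; U_{1:i-1}` it says that adding `X_i`
to the conditioning variables multiplies the conditional density of `Y_j` by one pair copula
density, so (a) telescopes, starting from `f_{Y_j}`. For the edge `V_1 V_2; U_{1:p}` it says that
adding `Y_j` multiplies `f_{Y_k|X}` by the last pair copula density; with (a) this gives (b).

Two points need care. The copula hypothesis concerns the transforms `F_v(Z_v)`, but the conclusion
is about `Z`: `IsPairCopula.sklar_of_pit` transfers it, since `F_v` is injective off a null set.
Moreover, `condDistrib` is determined only almost everywhere; `condDistrib_ae_eq_withDensity`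
identifies it with the quotient of densities. -/

namespace YVine

open Filter Topology ProbabilityTheory
open scoped ENNReal

/-! ### The probability integral transform of an atomless law -/

section ProbabilityIntegralTransform

variable (m : Measure ℝ) [IsProbabilityMeasure m]

lemma monotone_real_Iic : Monotone fun r => m.real (Iic r) := fun _ _ h =>
  measureReal_mono (Iic_subset_Iic.2 h)

lemma real_Iic_mem_Icc (r : ℝ) : m.real (Iic r) ∈ Icc (0 : ℝ) 1 :=
  ⟨measureReal_nonneg, measureReal_le_one⟩

lemma continuous_real_Iic [NullSingletonClass m] : Continuous fun r => m.real (Iic r) := by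
  have h : (fun r => m.real (Iic r)) = cdf m := by
    ext r; rw [cdf_eq_real]
  rw [h, continuous_iff_continuousAt]
  intro r
  rw [(cdf m).mono.continuousAt_iff_leftLim_eq_rightLim, StieltjesFunction.rightLim_eq]
  have := (cdf m).measure_singleton r
  rw [measure_cdf, measure_singleton] at this
  have h2 := (ENNReal.ofReal_eq_zero.1 this.symm)
  have h3 := (cdf m).mono.leftLim_le (le_refl r)
  linarith

/-- By monotonicity and continuity of the distribution function the sublevel set is a closed
half-line ending at its supremum, and the value there is `u` by the intermediate value theorem. -/
lemma measure_real_Iic_le [NullSingletonClass m] (u : ℝ) (hu : u ∈ Icc (0 : ℝ) 1) :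
    m {z | m.real (Iic z) ≤ u} = ENNReal.ofReal u := by
  have hcont := continuous_real_Iic m
  have hmono := monotone_real_Iic m
  have hbot : Tendsto (fun r => m.real (Iic r)) atBot (𝓝 0) := by
    simpa only [← cdf_eq_real] using tendsto_cdf_atBot m
  have htop : Tendsto (fun r => m.real (Iic r)) atTop (𝓝 1) := by
    simpa only [← cdf_eq_real] using tendsto_cdf_atTop m
  have hIic : ∀ s, m (Iic s) = ENNReal.ofReal (m.real (Iic s)) := fun s => by
    rw [ofReal_measureReal]
  -- At `u = 1` the sublevel set is the whole line and has no supremum; it can be empty only at `u =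
  -- 0`.
  rcases hu.2.eq_or_lt with rfl | hu1
  · have : {z | m.real (Iic z) ≤ 1} = univ := eq_univ_of_forall fun z => (real_Iic_mem_Icc m z).2
    rw [this]; simp
  set S := {z | m.real (Iic z) ≤ u} with hS
  obtain ⟨b, hb⟩ := (htop.eventually (lt_mem_nhds hu1)).exists
  have hbdd : BddAbove S := ⟨b, fun z hz => by
    by_contra! h
    exact absurd (hmono h.le) (not_le.2 (lt_of_le_of_lt hz hb))⟩
  have hclosed : IsClosed S := isClosed_le hcont continuous_const
  rcases S.eq_empty_or_nonempty with he | hne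
  · rcases hu.1.eq_or_lt with rfl | hu0
    · simp [he]
    · obtain ⟨a, ha⟩ := (hbot.eventually (gt_mem_nhds hu0)).exists
      exact absurd (show a ∈ S from ha.le) (by simp [he])
  have hmem : sSup S ∈ S := hclosed.csSup_mem hne hbdd
  have heq : S = Iic (sSup S) := by
    ext z
    exact ⟨fun hz => le_csSup hbdd hz, fun hz => (hmono hz).trans hmem⟩
  rw [heq, hIic]
  congr 1
  refine le_antisymm hmem ?_
  obtain ⟨r, hr⟩ : ∃ r, m.real (Iic r) = u := by
    have hx : sSup S ≤ b := csSup_le hne fun z hz => by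
      by_contra! h
      exact absurd (hmono h.le) (not_le.2 (lt_of_le_of_lt hz hb))
    obtain ⟨r, -, hr⟩ := intermediate_value_Icc hx hcont.continuousOn ⟨hmem, hb.le⟩
    exact ⟨r, hr⟩
  rw [← hr]
  exact hmono (le_csSup hbdd (show r ∈ S from hr.le))

lemma map_real_Iic [NullSingletonClass m] :
    m.map (fun r => m.real (Iic r)) = volume.restrict (Icc (0 : ℝ) 1) := by
  have hmeas : Measurable fun r => m.real (Iic r) := (monotone_real_Iic m).measurable
  have : IsProbabilityMeasure (m.map fun r => m.real (Iic r)) :=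
    Measure.isProbabilityMeasure_map hmeas.aemeasurable
  refine Measure.ext_of_Iic _ _ fun u => ?_
  rw [Measure.map_apply hmeas measurableSet_Iic, Measure.restrict_apply measurableSet_Iic]
  change m {z | m.real (Iic z) ≤ u} = _
  rcases lt_or_ge u 0 with h | h
  · have h1 : {z | m.real (Iic z) ≤ u} = ∅ := by
      ext z; simpa using lt_of_lt_of_le h (real_Iic_mem_Icc m z).1
    have h2 : Iic u ∩ Icc 0 1 = ∅ := by
      ext z; simp only [mem_inter_iff, mem_Iic, mem_Icc, mem_empty_iff_false, iff_false]
      rintro ⟨a, b, -⟩; linarith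
    simp [h1, h2]
  rcases le_or_gt u 1 with h1 | h1
  · rw [measure_real_Iic_le m u ⟨h, h1⟩]
    have h2 : Iic u ∩ Icc 0 1 = Icc 0 u := by
      ext z; simp only [mem_inter_iff, mem_Iic, mem_Icc]
      constructor
      · rintro ⟨a, b, -⟩; exact ⟨b, a⟩
      · rintro ⟨a, b⟩; exact ⟨b, a, b.trans h1⟩
    rw [h2]; simp
  · have h3 : {z | m.real (Iic z) ≤ u} = univ :=
      eq_univ_of_forall fun z => (real_Iic_mem_Icc m z).2.trans h1.le
    have h2 : Iic u ∩ Icc 0 1 = Icc 0 1 :=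
      inter_eq_right.2 fun z hz => hz.2.trans h1.le
    rw [h3, h2]; simp

lemma Iic_ae_eq_real_Iic_le [NullSingletonClass m] (r : ℝ) :
    Iic r =ᵐ[m] {z | m.real (Iic z) ≤ m.real (Iic r)} := by
  refine ae_eq_of_subset_of_measure_ge (fun z hz => monotone_real_Iic m hz) ?_
    measurableSet_Iic.nullMeasurableSet (measure_ne_top _ _)
  rw [measure_real_Iic_le m _ (real_Iic_mem_Icc m r), ofReal_measureReal]

/-- The points at which the distribution function is locally constant from the left. -/
def flatPoints : Set ℝ := {z | ∃ q : ℚ, (q : ℝ) < z ∧ m.real (Iic z) ≤ m.real (Iic (q : ℝ))}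

lemma measurableSet_flatPoints : MeasurableSet (flatPoints m) := by
  have : flatPoints m = ⋃ q : ℚ, (Ioi (q : ℝ) ∩ {z | m.real (Iic z) ≤ m.real (Iic (q : ℝ))}) := by
    ext z; simp [flatPoints]
  rw [this]
  exact MeasurableSet.iUnion fun q => measurableSet_Ioi.inter
    (measurableSet_le (monotone_real_Iic m).measurable measurable_const)

/-- Each rational `q` contributes the part of a sublevel set beyond `Iic q`, which is null by
`Iic_ae_eq_real_Iic_le`. -/
lemma measure_flatPoints [NullSingletonClass m] : m (flatPoints m) = 0 := by
  have : flatPoints m = ⋃ q : ℚ, ({z | m.real (Iic z) ≤ m.real (Iic (q : ℝ))} \ Iic (q : ℝ)) := by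
    ext z; simp [flatPoints, and_comm]
  rw [this]
  exact measure_iUnion_null fun q => (ae_le_set.1 (Iic_ae_eq_real_Iic_le m q).symm.le)

lemma le_of_real_Iic_le {r z : ℝ} (hz : z ∉ flatPoints m)
    (h : m.real (Iic z) ≤ m.real (Iic r)) : z ≤ r := by
  by_contra! hlt
  obtain ⟨q, hq, hqz⟩ := exists_rat_btwn hlt
  exact hz ⟨q, hqz, h.trans (monotone_real_Iic m hq.le)⟩

/-- Off the flat points the distribution function is injective, and an injective measurable map from
a standard Borel space is a measurable embedding (Lusin–Souslin). -/
lemma exists_measurable_leftInverse_real_Iic :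
    ∃ ψ : ℝ → ℝ, Measurable ψ ∧ ∀ z ∉ flatPoints m, ψ (m.real (Iic z)) = z := by
  let S := (flatPoints m)ᶜ
  have hS : MeasurableSet S := (measurableSet_flatPoints m).compl
  have : StandardBorelSpace S := hS.standardBorel
  have hemb : MeasurableEmbedding fun z : S => m.real (Iic (z : ℝ)) := by
    refine Measurable.measurableEmbedding
      ((monotone_real_Iic m).measurable.comp measurable_subtype_coe) fun a b hab => ?_
    exact Subtype.ext (le_antisymm (le_of_real_Iic_le m a.2 (le_of_eq hab))
      (le_of_real_Iic_le m b.2 (le_of_eq hab.symm)))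
  obtain ⟨ψ, hψ, h⟩ := hemb.exists_measurable_extend measurable_subtype_coe fun _ => ⟨0⟩
  exact ⟨ψ, hψ, fun z hz => congrFun h ⟨z, hz⟩⟩

end ProbabilityIntegralTransform

/-! ### Densities of bivariate distributions with a given copula density -/

lemma ext_of_Iic_prod {m m' : Measure (ℝ × ℝ)} [IsFiniteMeasure m]
    (h : ∀ r s, m (Iic r ×ˢ Iic s) = m' (Iic r ×ˢ Iic s)) : m = m' := by
  have hgen : (inferInstance : MeasurableSpace (ℝ × ℝ)) =
      .generateFrom (image2 (· ×ˢ ·) (range (Iic : ℝ → Set ℝ)) (range (Iic : ℝ → Set ℝ))) := by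
    refine (generateFrom_eq_prod ?_ ?_ ?_ ?_).symm
    · rw [← borel_eq_generateFrom_Iic]; exact (BorelSpace.measurable_eq (α := ℝ)).symm
    · rw [← borel_eq_generateFrom_Iic]; exact (BorelSpace.measurable_eq (α := ℝ)).symm
    all_goals
      exact ⟨fun n : ℕ => Iic (n : ℝ), fun n => ⟨n, rfl⟩, by
        refine eq_univ_of_forall fun x => ?_
        obtain ⟨n, hn⟩ := exists_nat_ge x
        exact mem_iUnion.2 ⟨n, hn⟩⟩
  refine Measure.ext_of_generateFrom_of_iUnion _ (fun n : ℕ => Iic (n : ℝ) ×ˢ Iic (n : ℝ)) hgen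
    (isPiSystem_Iic.prod isPiSystem_Iic) ?_ (fun n => ⟨_, ⟨n, rfl⟩, _, ⟨n, rfl⟩, rfl⟩)
    (fun n => measure_ne_top _ _) ?_
  · refine eq_univ_of_forall fun x => ?_
    obtain ⟨n, hn⟩ := exists_nat_ge (max x.1 x.2)
    exact mem_iUnion.2 ⟨n, (le_max_left _ _).trans hn, (le_max_right _ _).trans hn⟩
  · rintro _ ⟨_, ⟨r, rfl⟩, _, ⟨s, rfl⟩, rfl⟩
    exact h r s

lemma IsCopulaDensity.ofReal_copulaDF {c : ℝ × ℝ → ℝ} (hc : IsCopulaDensity c) {u v : ℝ}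
    (hu : u ∈ Icc (0 : ℝ) 1) (hv : v ∈ Icc (0 : ℝ) 1) :
    ENNReal.ofReal (copulaDF c u v) = ∫⁻ z in Icc 0 u ×ˢ Icc 0 v, ENNReal.ofReal (c z) := by
  have hle : ∫⁻ z in Icc 0 u ×ˢ Icc 0 v, ENNReal.ofReal (c z) ≤ ENNReal.ofReal u := by
    rw [← hc.margin_left u hu]
    exact lintegral_mono_set (prod_mono subset_rfl (Icc_subset_Icc_right hv.2))
  rw [copulaDF, integral_eq_lintegral_of_nonneg_ae (ae_of_all _ hc.nonneg)
    hc.measurable.aestronglyMeasurable, ENNReal.ofReal_toReal]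
  exact (hle.trans_lt ENNReal.ofReal_lt_top).ne

/-- Change of variables by the two distribution functions: they push `a.prod b` to the uniform law
on the unit square, and the quadrant is, up to a null set, the preimage of a quadrant. -/
lemma lintegral_copula_comp {c : ℝ × ℝ → ℝ} (hc : IsCopulaDensity c) (a b : Measure ℝ)
    [IsProbabilityMeasure a] [IsProbabilityMeasure b] [NullSingletonClass a] [NullSingletonClass b] (r s : ℝ) :
    ∫⁻ z in Iic r ×ˢ Iic s, ENNReal.ofReal (c (a.real (Iic z.1), b.real (Iic z.2))) ∂(a.prod b) =
      ENNReal.ofReal (copulaDF c (a.real (Iic r)) (b.real (Iic s))) := by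
  have ha : Measurable fun r => a.real (Iic r) := (monotone_real_Iic a).measurable
  have hb : Measurable fun r => b.real (Iic r) := (monotone_real_Iic b).measurable
  have hmap : (a.prod b).map (Prod.map (fun r => a.real (Iic r)) (fun s => b.real (Iic s))) =
      volume.restrict (Icc 0 1 ×ˢ Icc 0 1) := by
    rw [← Measure.map_prod_map _ _ ha hb, map_real_Iic, map_real_Iic, Measure.prod_restrict]
    rfl
  have hset : (Iic r ×ˢ Iic s : Set (ℝ × ℝ)) =ᵐ[a.prod b]
      Prod.map (fun r => a.real (Iic r)) (fun s => b.real (Iic s)) ⁻¹'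
        (Iic (a.real (Iic r)) ×ˢ Iic (b.real (Iic s))) :=
    Measure.set_prod_ae_eq (Iic_ae_eq_real_Iic_le a r) (Iic_ae_eq_real_Iic_le b s)
  have hinter : (Iic (a.real (Iic r)) ×ˢ Iic (b.real (Iic s))) ∩ (Icc 0 1 ×ˢ Icc 0 1) =
      Icc 0 (a.real (Iic r)) ×ˢ Icc 0 (b.real (Iic s)) := by
    have h1 := (real_Iic_mem_Icc a r).2
    have h2 := (real_Iic_mem_Icc b s).2
    ext ⟨x, y⟩
    simp only [mem_inter_iff, mem_prod, mem_Iic, mem_Icc]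
    constructor
    · rintro ⟨⟨_, _⟩, ⟨_, _⟩, ⟨_, _⟩⟩; refine ⟨⟨?_, ?_⟩, ⟨?_, ?_⟩⟩ <;> assumption
    · rintro ⟨⟨_, _⟩, ⟨_, _⟩⟩; refine ⟨⟨?_, ?_⟩, ⟨?_, ?_⟩, ⟨?_, ?_⟩⟩ <;> first | assumption | linarith
  rw [hc.ofReal_copulaDF (real_Iic_mem_Icc a r) (real_Iic_mem_Icc b s), setLIntegral_congr hset,
    ← hinter, ← Measure.restrict_restrict (measurableSet_Iic.prod measurableSet_Iic), ← hmap,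
    setLIntegral_map (measurableSet_Iic.prod measurableSet_Iic) hc.measurable.ennreal_ofReal
      (ha.prodMap hb)]
  rfl

/-- Sklar's theorem for densities. -/
lemma density_eq_of_copulaDF {c : ℝ × ℝ → ℝ} (hc : IsCopulaDensity c) {h : ℝ × ℝ → ℝ≥0∞}
    {f g : ℝ → ℝ≥0∞} (hh : Measurable h) (hf : Measurable f) (hg : Measurable g)
    (m : Measure (ℝ × ℝ)) (a b : Measure ℝ) [IsProbabilityMeasure m]
    [IsProbabilityMeasure a] [IsProbabilityMeasure b]
    (hm : m = volume.withDensity h) (ha : a = volume.withDensity f) (hb : b = volume.withDensity g)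
    (hsklar : ∀ r s, m.real (Iic r ×ˢ Iic s) = copulaDF c (a.real (Iic r)) (b.real (Iic s))) :
    ∀ᵐ z : ℝ × ℝ, h z =
      ENNReal.ofReal (c (a.real (Iic z.1), b.real (Iic z.2))) * (f z.1 * g z.2) := by
  have hFa : Measurable fun r => a.real (Iic r) := (monotone_real_Iic a).measurable
  have hFb : Measurable fun r => b.real (Iic r) := (monotone_real_Iic b).measurable
  have hcm : Measurable fun z : ℝ × ℝ =>
      ENNReal.ofReal (c (a.real (Iic z.1), b.real (Iic z.2))) :=
    (hc.measurable.comp ((hFa.comp measurable_fst).prodMk (hFb.comp measurable_snd))).ennreal_ofReal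
  have : NullSingletonClass a := by rw [ha]; infer_instance
  have : NullSingletonClass b := by rw [hb]; infer_instance
  have hprod : a.prod b = volume.withDensity fun z : ℝ × ℝ => f z.1 * g z.2 := by
    have : SFinite (volume.withDensity f) := by rw [← ha]; infer_instance
    have : SFinite (volume.withDensity g) := by rw [← hb]; infer_instance
    rw [ha, hb, prod_withDensity hf hg]; rfl
  -- Both measures agree on quadrants, which is exactly Sklar's equation.
  have key : m = (a.prod b).withDensity fun z =>
      ENNReal.ofReal (c (a.real (Iic z.1), b.real (Iic z.2))) := by
    refine ext_of_Iic_prod fun r s => ?_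
    rw [withDensity_apply _ (measurableSet_Iic.prod measurableSet_Iic),
      lintegral_copula_comp hc a b r s, ← hsklar, ofReal_measureReal]
  have hfg : Measurable fun z : ℝ × ℝ => f z.1 * g z.2 :=
    (hf.comp measurable_fst).mul (hg.comp measurable_snd)
  rw [hprod, ← withDensity_mul _ hfg hcm, hm] at key
  have hfin : ∫⁻ z, h z ≠ ∞ := by
    rw [← setLIntegral_univ, ← withDensity_apply _ MeasurableSet.univ, ← hm]
    exact measure_ne_top _ _
  filter_upwards [(withDensity_eq_iff hh.aemeasurable (hfg.mul hcm).aemeasurable hfin).1 key]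
    with z hz
  rw [hz, Pi.mul_apply, mul_comm]

/-! ### Conditional distributions -/

section CondDistrib

variable {Ω : Type*} [MeasurableSpace Ω] {P : Measure Ω} [IsProbabilityMeasure P]
  {E F : Type*} [MeasurableSpace E] [MeasurableSpace F] [StandardBorelSpace F] [Nonempty F]

/-- The quotients define a kernel that disintegrates the joint law over `P.map T`, and such a kernel
is almost everywhere unique. -/
lemma condDistrib_ae_eq_withDensity {T : Ω → E} {S : Ω → F} (hT : Measurable T)
    (hS : Measurable S) {μ : Measure E} {ν : Measure F} [SigmaFinite μ] [SigmaFinite ν]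
    {g : E → ℝ≥0∞} {h : E × F → ℝ≥0∞} (hg : Measurable g) (hh : Measurable h)
    (hgT : P.map T = μ.withDensity g)
    (hhT : P.map (fun ω => (T ω, S ω)) = (μ.prod ν).withDensity h) :
    ∀ᵐ t ∂(P.map T), condDistrib S T P t = ν.withDensity fun s => h (t, s) / g t := by
  have : IsProbabilityMeasure (P.map T) := Measure.isProbabilityMeasure_map hT.aemeasurable
  have hint : Measurable fun t => ∫⁻ s, h (t, s) ∂ν := hh.lintegral_prod_right'
  have hgfin : ∫⁻ t, g t ∂μ ≠ ∞ := by
    rw [← setLIntegral_univ, ← withDensity_apply _ MeasurableSet.univ, ← hgT]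
    exact measure_ne_top _ _
  have hmarg : g =ᵐ[μ] fun t => ∫⁻ s, h (t, s) ∂ν := by
    refine (withDensity_eq_iff hg.aemeasurable hint.aemeasurable hgfin).1 ?_
    rw [← hgT]
    ext A hA
    have h1 : P.map T A = P.map (fun ω => (T ω, S ω)) (A ×ˢ univ) := by
      rw [Measure.map_apply hT hA, Measure.map_apply (hT.prodMk hS) (hA.prod MeasurableSet.univ)]
      congr 1; ext; simp
    rw [h1, hhT, withDensity_apply _ (hA.prod MeasurableSet.univ), withDensity_apply _ hA,
      setLIntegral_prod _ hh.aemeasurable]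
    simp
  have hq : Measurable fun x : E × F => h x / g x.1 := hh.div (hg.comp measurable_fst)
  -- On a null set for the law of `T` the quotient may have infinite mass. Setting it to zero
  -- outside `B` makes the kernel finite.
  let B : Set E := {t | ∫⁻ s, h (t, s) / g t ∂ν ≤ 1}
  have hB : MeasurableSet B := measurableSet_le hq.lintegral_prod_right' measurable_const
  let k : E → F → ℝ≥0∞ := fun t s => (B ×ˢ univ).indicator (fun x => h x / g x.1) (t, s)
  have hk : Measurable (Function.uncurry k) := hq.indicator (hB.prod MeasurableSet.univ)
  have hkB : ∀ t ∈ B, k t = fun s => h (t, s) / g t := fun t ht => by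
    ext s; exact indicator_of_mem (by simpa using ht) _
  have hkB' : ∀ t ∉ B, k t = fun s => 0 := fun t ht => by
    ext s; exact indicator_of_notMem (by simpa using ht) _
  let η : Kernel E F := Kernel.withDensity (Kernel.const E ν) k
  have hη : ∀ t, η t = ν.withDensity (k t) := fun t => by
    rw [Kernel.withDensity_apply _ hk, Kernel.const_apply]
  have hηfin : IsFiniteKernel η := by
    refine ⟨⟨1, ENNReal.one_lt_top, fun t => ?_⟩⟩
    rw [hη, withDensity_apply _ MeasurableSet.univ, setLIntegral_univ]
    by_cases ht : t ∈ B
    · rw [hkB t ht]; exact ht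
    · rw [hkB' t ht]; simp
  have hgae : ∀ᵐ t ∂μ, g t ≠ 0 → t ∈ B := by
    filter_upwards [hmarg, ae_lt_top hg hgfin] with t ht ht' ht0
    change ∫⁻ s, h (t, s) / g t ∂ν ≤ 1
    simp only [div_eq_mul_inv]
    rw [lintegral_mul_const _ (by fun_prop), ← ht, ENNReal.mul_inv_cancel ht0 ht'.ne]
  have hcomp : P.map (fun ω => (T ω, S ω)) = P.map T ⊗ₘ η := by
    ext A hA
    rw [Measure.compProd_apply hA, hhT, withDensity_apply _ hA,
      ← lintegral_indicator hA, lintegral_prod _ (hh.indicator hA).aemeasurable, hgT,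
      lintegral_withDensity_eq_lintegral_mul _ hg (Kernel.measurable_kernel_prodMk_left hA)]
    refine lintegral_congr_ae ?_
    filter_upwards [hmarg, ae_lt_top hg hgfin, hgae] with t ht ht' htB
    have hAt : MeasurableSet (Prod.mk t ⁻¹' A) := measurable_prodMk_left hA
    have hht : Measurable fun s => h (t, s) := by fun_prop
    have h2 : ∫⁻ s, A.indicator h (t, s) ∂ν = ∫⁻ s in Prod.mk t ⁻¹' A, h (t, s) ∂ν := by
      rw [← lintegral_indicator hAt]; rfl
    rw [h2, Pi.mul_apply, hη, withDensity_apply _ hAt]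
    -- Where `g t = 0` the slice `h (t, ·)` integrates to zero, so both sides vanish whatever the
    -- quotient is.
    by_cases h0 : g t = 0
    · rw [h0, zero_mul]
      rw [h0] at ht
      exact le_antisymm ((setLIntegral_le_lintegral _ _).trans ht.symm.le) zero_le
    · rw [hkB t (htB h0), ← lintegral_const_mul _ (hht.div_const _)]
      refine lintegral_congr fun s => ?_
      rw [ENNReal.mul_div_cancel h0 ht'.ne]
  have hres := condDistrib_ae_eq_of_measure_eq_compProd T hS.aemeasurable hcomp
  have hB' : ∀ᵐ t ∂(P.map T), t ∈ B := by
    rw [hgT, ae_withDensity_iff hg]; exact hgae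
  filter_upwards [hres, hB'] with t ht htB
  rw [ht, hη, hkB t htB]

lemma condDistrib_ae_null {T : Ω → E} {S : Ω → F} (hT : Measurable T) (hS : Measurable S)
    {M : Set F} (hM : MeasurableSet M) (h : P.map S M = 0) :
    ∀ᵐ t ∂(P.map T), condDistrib S T P t M = 0 := by
  rw [← condDistrib_comp_map hT.aemeasurable hS.aemeasurable,
    Measure.bind_apply hM (Kernel.aemeasurable _),
    lintegral_eq_zero_iff (Kernel.measurable_coe _ hM)] at h
  exact h

/-- Conditioning on `T` and on an almost surely invertible function of `T` are the same. -/
lemma condDistrib_comp_of_leftInverse {E' : Type*} [MeasurableSpace E'] {T : Ω → E} {S : Ω → F}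
    (hT : Measurable T) (hS : Measurable S) {φ : E → E'} (hφ : Measurable φ) {ψ : E' → E}
    (hψ : Measurable ψ) (h : ∀ᵐ t ∂(P.map T), ψ (φ t) = t) :
    ∀ᵐ t ∂(P.map T), condDistrib S T P t = condDistrib S (φ ∘ T) P (φ t) := by
  -- As `T = ψ (φ T)` almost surely, the joint law with `T` is the image under `ψ` of the one with
  -- `φ ∘ T`; hence the kernel pulled back along `φ` disintegrates it.
  have hcomp : P.map (fun ω => (T ω, S ω)) =
      P.map T ⊗ₘ (condDistrib S (φ ∘ T) P).comap φ hφ := by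
    have h1 : P.map (fun ω => (T ω, S ω)) =
        (P.map (fun ω => ((φ ∘ T) ω, S ω))).map (Prod.map ψ id) := by
      rw [Measure.map_map (hψ.prodMap measurable_id) ((hφ.comp hT).prodMk hS)]
      refine Measure.map_congr ?_
      filter_upwards [ae_of_ae_map hT.aemeasurable h] with ω hω
      simp [hω]
    rw [h1, ← compProd_map_condDistrib hS.aemeasurable]
    ext A hA
    rw [Measure.map_apply (hψ.prodMap measurable_id) hA,
      Measure.compProd_apply ((hψ.prodMap measurable_id) hA), Measure.compProd_apply hA,
      ← Measure.map_map hφ hT, lintegral_map (Kernel.measurable_kernel_prodMk_left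
        ((hψ.prodMap measurable_id) hA)) hφ]
    refine lintegral_congr_ae ?_
    filter_upwards [h] with t ht
    rw [Kernel.comap_apply]
    congr 1
    ext s
    simp [ht]
  have hres := condDistrib_ae_eq_of_measure_eq_compProd T hS.aemeasurable hcomp
  filter_upwards [hres] with t ht
  rw [ht, Kernel.comap_apply]

end CondDistrib

/-! ### Sklar's theorem conditionally on a random vector -/

section CondSklar

variable {Ω : Type*} [MeasurableSpace Ω] {P : Measure Ω} [IsProbabilityMeasure P]

lemma measurable_kernel_real_Iic {E : Type*} [MeasurableSpace E] (κ : Kernel E ℝ)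
    [IsFiniteKernel κ] : Measurable fun x : E × ℝ => (κ x.1).real (Iic x.2) := by
  have hset : MeasurableSet {w : (E × ℝ) × ℝ | w.2 ≤ w.1.2} :=
    measurableSet_le (by fun_prop) (by fun_prop)
  exact (Kernel.measurable_kernel_prodMk_left (κ := κ.comap Prod.fst measurable_fst)
    hset).ennreal_toReal

/-- For fixed `t` this is `density_eq_of_copulaDF` for the three conditional laws, multiplied by `g
t` squared; Fubini for null sets then lets `t` vary. -/
lemma joint_density_eq_of_sklar {E : Type*} [MeasurableSpace E] {T : Ω → E} {A B : Ω → ℝ}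
    (hT : Measurable T) (hA : Measurable A) (hB : Measurable B) {μ : Measure E} [SigmaFinite μ]
    {g : E → ℝ≥0∞} {gA gB : E × ℝ → ℝ≥0∞} {h : E × (ℝ × ℝ) → ℝ≥0∞} (hg : Measurable g)
    (hgA : Measurable gA) (hgB : Measurable gB) (hh : Measurable h)
    (hgT : P.map T = μ.withDensity g)
    (hgTA : P.map (fun ω => (T ω, A ω)) = (μ.prod volume).withDensity gA)
    (hgTB : P.map (fun ω => (T ω, B ω)) = (μ.prod volume).withDensity gB)
    (hhT : P.map (fun ω => (T ω, (A ω, B ω))) = (μ.prod volume).withDensity h)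
    {c : ℝ × ℝ → ℝ} (hc : IsCopulaDensity c)
    (hsklar : ∀ᵐ t ∂(P.map T), ∀ r s,
      (condDistrib (fun ω => (A ω, B ω)) T P t).real (Iic r ×ˢ Iic s) =
        copulaDF c ((condDistrib A T P t).real (Iic r)) ((condDistrib B T P t).real (Iic s))) :
    ∀ᵐ z ∂(μ.prod volume), g z.1 ≠ 0 → h z * g z.1 =
      ENNReal.ofReal (c ((condDistrib A T P z.1).real (Iic z.2.1),
        (condDistrib B T P z.1).real (Iic z.2.2))) * (gA (z.1, z.2.1) * gB (z.1, z.2.2)) := by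
  have : IsProbabilityMeasure (P.map T) := Measure.isProbabilityMeasure_map hT.aemeasurable
  have hgfin : ∫⁻ t, g t ∂μ ≠ ∞ := by
    rw [← setLIntegral_univ, ← withDensity_apply _ MeasurableSet.univ, ← hgT]
    exact measure_ne_top _ _
  have hkA := measurable_kernel_real_Iic (condDistrib A T P)
  have hkB := measurable_kernel_real_Iic (condDistrib B T P)
  have hcm : Measurable fun z : E × (ℝ × ℝ) => c ((condDistrib A T P z.1).real (Iic z.2.1),
      (condDistrib B T P z.1).real (Iic z.2.2)) :=
    hc.measurable.comp
      ((hkA.comp (measurable_fst.prodMk (measurable_fst.comp measurable_snd))).prodMk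
        (hkB.comp (measurable_fst.prodMk (measurable_snd.comp measurable_snd))))
  have hmset : MeasurableSet {z : E × (ℝ × ℝ) | g z.1 ≠ 0 → h z * g z.1 =
      ENNReal.ofReal (c ((condDistrib A T P z.1).real (Iic z.2.1),
        (condDistrib B T P z.1).real (Iic z.2.2))) * (gA (z.1, z.2.1) * gB (z.1, z.2.2))} := by
    have h1 : MeasurableSet {z : E × (ℝ × ℝ) | g z.1 ≠ 0} :=
      (measurableSet_eq_fun (hg.comp measurable_fst) measurable_const).compl
    have h2 : MeasurableSet {z : E × (ℝ × ℝ) | h z * g z.1 =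
      ENNReal.ofReal (c ((condDistrib A T P z.1).real (Iic z.2.1),
        (condDistrib B T P z.1).real (Iic z.2.2))) * (gA (z.1, z.2.1) * gB (z.1, z.2.2))} :=
      measurableSet_eq_fun (by fun_prop) (hcm.ennreal_ofReal.mul (by fun_prop))
    exact h1.imp h2
  rw [Measure.ae_prod_iff_ae_ae hmset]
  have hall := ((condDistrib_ae_eq_withDensity hT hA hg hgA hgT hgTA).and
    (condDistrib_ae_eq_withDensity hT hB hg hgB hgT hgTB)).and
    ((condDistrib_ae_eq_withDensity hT (hA.prodMk hB) hg hh hgT hhT).and hsklar)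
  rw [hgT, ae_withDensity_iff hg] at hall
  filter_upwards [hall, ae_lt_top hg hgfin] with t ht htop
  by_cases h0 : g t = 0
  · simp [h0]
  obtain ⟨⟨h1, h2⟩, h3, h4⟩ := ht h0
  filter_upwards [density_eq_of_copulaDF hc (by fun_prop) (by fun_prop) (by fun_prop)
    _ _ _ h3 h1 h2 h4] with z hz _
  rw [ENNReal.div_eq_inv_mul, ENNReal.div_eq_inv_mul, ENNReal.div_eq_inv_mul] at hz
  have hi : (g t)⁻¹ * g t = 1 := ENNReal.inv_mul_cancel h0 htop.ne
  calc h (t, z) * g t = g t * g t * ((g t)⁻¹ * h (t, z)) := by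
        rw [show g t * g t * ((g t)⁻¹ * h (t, z)) = (g t)⁻¹ * g t * (h (t, z) * g t) by ring,
          hi, one_mul]
    _ = (g t)⁻¹ * g t * ((g t)⁻¹ * g t) * (ENNReal.ofReal (c ((condDistrib A T P t).real
          (Iic z.1), (condDistrib B T P t).real (Iic z.2))) * (gA (t, z.1) * gB (t, z.2))) := by
        rw [hz]; ring
    _ = _ := by rw [hi]; simp

/-- The copula of `Z_x` and `Z_y` given `Z_D` is that of their probability integral transforms. -/
lemma IsPairCopula.sklar_of_pit {ι : Type*} {Z : ι → Ω → ℝ} (hZ : ∀ v, Measurable (Z v))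
    (hatom : ∀ v, NullSingletonClass (P.map (Z v))) {x y : ι} {D : Finset ι} {c : ℝ × ℝ → ℝ}
    (hc : IsPairCopula P (pit P Z) x y D c) :
    ∀ᵐ t ∂(P.map (subvec Z D)), ∀ r s : ℝ,
      condDF₂ P Z x y D r s t = copulaDF c (condDF P Z x D r t) (condDF P Z y D s t) := by
  have hprob : ∀ v, IsProbabilityMeasure (P.map (Z v)) := fun v =>
    Measure.isProbabilityMeasure_map (hZ v).aemeasurable
  let G : ι → ℝ → ℝ := fun v z => (P.map (Z v)).real (Iic z)
  have hG : ∀ v, Measurable (G v) := fun v => (monotone_real_Iic _).measurable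
  let φ : (D → ℝ) → (D → ℝ) := fun t a => G a (t a)
  have hφ : Measurable φ := measurable_pi_lambda _ fun a => (hG a).comp (measurable_pi_apply a)
  have hT : Measurable (subvec Z D) := measurable_pi_lambda _ fun a => hZ a
  have hpit : ∀ v, pit P Z v = G v ∘ Z v := fun v => by
    ext ω; exact cdf_eq_real _ _
  have hsub : subvec (pit P Z) D = φ ∘ subvec Z D := by
    ext ω a; exact congrFun (hpit a) ω
  choose ψ hψ hψG using fun v => exists_measurable_leftInverse_real_Iic (P.map (Z v))
  have hnull : ∀ v, ∀ᵐ z ∂(P.map (Z v)), z ∉ flatPoints (P.map (Z v)) := fun v =>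
    measure_eq_zero_iff_ae_notMem.1 (measure_flatPoints _)
  have hinv : ∀ᵐ t ∂(P.map (subvec Z D)), (fun a : D => ψ a (φ t a)) = t := by
    have h1 : ∀ a : D, ∀ᵐ t ∂(P.map (subvec Z D)), t a ∉ flatPoints (P.map (Z a)) := fun a => by
      have h2 := hnull a
      have h3 : P.map (Z a) = (P.map (subvec Z D)).map fun t => t a := by
        rw [Measure.map_map (measurable_pi_apply a) hT]; rfl
      rw [h3] at h2
      have h4 := ae_of_ae_map (measurable_pi_apply a).aemeasurable h2
      rwa [← h3] at h4
    filter_upwards [ae_all_iff.2 h1] with t ht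
    ext a
    exact hψG a _ (ht a)
  have hψm : Measurable fun (t : D → ℝ) (a : D) => ψ a (t a) :=
    measurable_pi_lambda _ fun a => (hψ a).comp (measurable_pi_apply a)
  have hsk := hc.sklar
  rw [hsub, ← Measure.map_map hφ hT] at hsk
  have hsk := ae_of_ae_map hφ.aemeasurable hsk
  -- The conditional law also gives the flat points mass zero, and off them `G v z ≤ G v r` is
  -- equivalent to `z ≤ r`.
  have hmarg : ∀ v, ∀ᵐ t ∂(P.map (subvec Z D)), ∀ r,
      condDF P (pit P Z) v D (G v r) (φ t) = condDF P Z v D r t := fun v => by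
    have h1 := condDistrib_comp_of_leftInverse hT ((hG v).comp (hZ v)) hφ hψm hinv
    have h2 := condDistrib_comp (mβ := MeasurableSpace.pi) (μ := P) (subvec Z D) (hZ v).aemeasurable (hG v)
    have h3 := condDistrib_ae_null hT (hZ v) (measurableSet_flatPoints (P.map (Z v)))
      (measure_flatPoints _)
    filter_upwards [h1, h2, h3] with t h1 h2 h3 r
    rw [condDF, condDF, hsub, hpit, ← h1, h2, Kernel.map_apply _ (hG v),
      map_measureReal_apply (hG v) measurableSet_Iic]
    refine measureReal_congr ?_
    filter_upwards [measure_eq_zero_iff_ae_notMem.1 h3] with z hz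
    exact propext ⟨fun h => le_of_real_Iic_le _ hz h, fun h => monotone_real_Iic _ h⟩
  have hjoint : ∀ᵐ t ∂(P.map (subvec Z D)), ∀ r s,
      condDF₂ P (pit P Z) x y D (G x r) (G y s) (φ t) = condDF₂ P Z x y D r s t := by
    have hS : Measurable fun ω => (Z x ω, Z y ω) := (hZ x).prodMk (hZ y)
    have hGG := (hG x).prodMap (hG y)
    have h1 := condDistrib_comp_of_leftInverse hT (hGG.comp hS) hφ hψm hinv
    have h2 := condDistrib_comp (mβ := MeasurableSpace.pi) (μ := P) (subvec Z D) hS.aemeasurable hGG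
    have hx0 : P.map (fun ω => (Z x ω, Z y ω)) (Prod.fst ⁻¹' flatPoints (P.map (Z x))) = 0 := by
      rw [Measure.map_apply hS (measurable_fst (measurableSet_flatPoints _))]
      have := measure_flatPoints (P.map (Z x))
      rwa [Measure.map_apply (hZ x) (measurableSet_flatPoints _)] at this
    have hy0 : P.map (fun ω => (Z x ω, Z y ω)) (Prod.snd ⁻¹' flatPoints (P.map (Z y))) = 0 := by
      rw [Measure.map_apply hS (measurable_snd (measurableSet_flatPoints _))]
      have := measure_flatPoints (P.map (Z y))
      rwa [Measure.map_apply (hZ y) (measurableSet_flatPoints _)] at this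
    have h3 := condDistrib_ae_null hT hS (measurable_fst (measurableSet_flatPoints _)) hx0
    have h4 := condDistrib_ae_null hT hS (measurable_snd (measurableSet_flatPoints _)) hy0
    filter_upwards [h1, h2, h3, h4] with t h1 h2 h3 h4 r s
    have hp : (fun ω => (pit P Z x ω, pit P Z y ω)) =
        Prod.map (G x) (G y) ∘ fun ω => (Z x ω, Z y ω) := by
      ext ω
      · exact congrFun (hpit x) ω
      · exact congrFun (hpit y) ω
    rw [condDF₂, condDF₂, hsub, hp, ← h1, h2, Kernel.map_apply _ hGG,
      map_measureReal_apply hGG (measurableSet_Iic.prod measurableSet_Iic)]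
    refine measureReal_congr ?_
    filter_upwards [measure_eq_zero_iff_ae_notMem.1 h3, measure_eq_zero_iff_ae_notMem.1 h4]
      with z hz hz'
    exact propext ⟨fun h => ⟨le_of_real_Iic_le _ hz h.1, le_of_real_Iic_le _ hz' h.2⟩,
      fun h => ⟨monotone_real_Iic _ h.1, monotone_real_Iic _ h.2⟩⟩
  filter_upwards [hsk, hmarg x, hmarg y, hjoint] with t h hx hy hxy r s
  rw [← hxy, ← hx, ← hy]
  exact h _ _

end CondSklar

/-! ### Coordinate projections and Lebesgue measure -/

section Coordinates

variable {ι : Type*} [DecidableEq ι]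

/-- Splitting off one coordinate. -/
def insertEquiv (x : ι) (D : Finset ι) (hx : x ∉ D) :
    (↥(insert x D) → ℝ) ≃ᵐ (D → ℝ) × ℝ where
  toFun w := (fun a => w ⟨a, Finset.mem_insert_of_mem a.2⟩, w ⟨x, Finset.mem_insert_self x D⟩)
  invFun w a := if h : (a : ι) = x then w.2
    else w.1 ⟨a, Finset.mem_of_mem_insert_of_ne a.2 h⟩
  left_inv w := by
    ext a
    by_cases h : (a : ι) = x
    · simp only [h, dite_true]; congr 1; exact Subtype.ext h.symm
    · simp [h]
  right_inv w := by
    refine Prod.ext ?_ (by simp)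
    ext a
    have : (a : ι) ≠ x := fun h => hx (h ▸ a.2)
    simp [this]
  measurable_toFun := by
    refine Measurable.prodMk (measurable_pi_lambda _ fun a => measurable_pi_apply _)
      (measurable_pi_apply _)
  measurable_invFun := by
    refine measurable_pi_lambda _ fun a => ?_
    by_cases h : (a : ι) = x
    · simpa [h] using measurable_snd
    · simpa [h, Function.comp_def] using (measurable_pi_apply
        (⟨a, Finset.mem_of_mem_insert_of_ne a.2 h⟩ : D)).comp
          (measurable_fst : Measurable (Prod.fst : (D → ℝ) × ℝ → D → ℝ))

lemma volume_preserving_insertEquiv (x : ι) (D : Finset ι) (hx : x ∉ D) :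
    MeasurePreserving (insertEquiv x D hx) := by
  refine MeasurePreserving.symm (insertEquiv x D hx).symm
    ⟨(insertEquiv x D hx).symm.measurable, ?_⟩
  refine (Measure.pi_eq fun s hs => ?_).symm
  -- Extending the sides of the box to all indices turns products over subtypes into products over
  -- finsets, where `Finset.prod_insert` applies.
  let s' : ι → Set ℝ := fun v => if h : v ∈ insert x D then s ⟨v, h⟩ else univ
  have hs' : ∀ a : ↥(insert x D), s a = s' a := fun a => by simp [s', -Finset.mem_insert]
  have hpre : (insertEquiv x D hx).symm ⁻¹' (univ.pi s) =
      (univ.pi fun a : D => s' a) ×ˢ s' x := by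
    ext w
    simp only [mem_preimage, Set.mem_pi, mem_univ, true_imp_iff, mem_prod]
    constructor
    · intro h
      refine ⟨fun a => ?_, ?_⟩
      · have := h ⟨a, Finset.mem_insert_of_mem a.2⟩
        rw [hs'] at this
        have hax : (a : ι) ≠ x := fun h => hx (h ▸ a.2)
        simpa [insertEquiv, hax] using this
      · have := h ⟨x, Finset.mem_insert_self x D⟩
        rw [hs'] at this
        simpa [insertEquiv] using this
    · rintro ⟨h1, h2⟩ a
      rw [hs']
      by_cases h : (a : ι) = x
      · simpa [insertEquiv, h] using h2
      · simpa [insertEquiv, h] using h1 ⟨a, Finset.mem_of_mem_insert_of_ne a.2 h⟩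
  rw [MeasurableEquiv.map_apply, hpre]
  simp only [hs']
  rw [Finset.prod_coe_sort (insert x D) fun v => volume (s' v), Finset.prod_insert hx,
    ← Finset.prod_coe_sort D fun v => volume (s' v), Measure.volume_eq_prod, Measure.prod_prod,
    volume_pi_pi, mul_comm]

/-- Splitting off two coordinates. -/
def insertEquiv₂ (x y : ι) (D : Finset ι) (hx : x ∉ D) (hy : y ∉ insert x D) :
    (↥(insert y (insert x D)) → ℝ) ≃ᵐ (D → ℝ) × (ℝ × ℝ) :=
  ((insertEquiv y (insert x D) hy).trans
    ((insertEquiv x D hx).prodCongr (MeasurableEquiv.refl ℝ))).trans MeasurableEquiv.prodAssoc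

lemma volume_preserving_insertEquiv₂ (x y : ι) (D : Finset ι) (hx : x ∉ D)
    (hy : y ∉ insert x D) : MeasurePreserving (insertEquiv₂ x y D hx hy) :=
  volume_preserving_prodAssoc.comp
    (((volume_preserving_insertEquiv x D hx).prod (MeasurePreserving.id volume)).comp
      (volume_preserving_insertEquiv y (insert x D) hy))

/-- Used to pull almost-everywhere statements about a subvector back to the space of all variables.
-/
lemma quasiMeasurePreserving_restrict [Fintype ι] (A : Finset ι) :
    Measure.QuasiMeasurePreserving (fun (z : ι → ℝ) (a : A) => z a) := by
  have h := Measure.quasiMeasurePreserving_fst.comp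
    (volume_preserving_piEquivPiSubtypeProd (fun _ : ι => ℝ) (· ∈ A)).quasiMeasurePreserving
  convert! h

lemma map_equiv_eq_withDensity {Ω E F : Type*} [MeasurableSpace Ω] [MeasurableSpace E]
    [MeasurableSpace F] {P : Measure Ω} {S : Ω → E} (hS : Measurable S) {μ : Measure E}
    {ν : Measure F} {f : E → ℝ≥0∞} (h : P.map S = μ.withDensity f) (e : E ≃ᵐ F)
    (he : MeasurePreserving e μ ν) : P.map (fun ω => e (S ω)) = ν.withDensity (f ∘ e.symm) := by
  have h1 : P.map (fun ω => e (S ω)) = (P.map S).map e := (Measure.map_map e.measurable hS).symm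
  ext A hA
  rw [h1, h, e.map_apply, withDensity_apply _ (e.measurable hA), withDensity_apply _ hA,
    ← he.setLIntegral_comp_preimage_emb e.measurableEmbedding]
  simp

end Coordinates

/-! ### Marginal densities -/

lemma measurable_subvec {Ω ι : Type*} [MeasurableSpace Ω] {Z : ι → Ω → ℝ}
    (hZ : ∀ v, Measurable (Z v)) (A : Finset ι) : Measurable (subvec Z A) :=
  measurable_pi_lambda _ fun a => hZ a

lemma map_absolutelyContinuous {Ω ι : Type*} [MeasurableSpace Ω] [Fintype ι] {P : Measure Ω}
    {Z : ι → Ω → ℝ} (hZ : ∀ v, Measurable (Z v)) (hf : HasPDF (fun ω v => Z v ω) P volume)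
    (v : ι) : P.map (Z v) ≪ volume := by
  have hq := Measure.quasiMeasurePreserving_eval (fun _ : ι => (volume : Measure ℝ)) v
  have h : P.map (Z v) = (P.map fun ω v => Z v ω).map (Function.eval v) := by
    rw [Measure.map_map hq.measurable (measurable_pi_lambda _ hZ)]; rfl
  rw [h]
  exact (hf.absolutelyContinuous.map hq.measurable).trans hq.absolutelyContinuous

section Densities

variable {Ω : Type*} [MeasurableSpace Ω] {P : Measure Ω} [IsProbabilityMeasure P]
  {ι : Type*} [Fintype ι] [DecidableEq ι] {Z : ι → Ω → ℝ}

lemma hasPDF_subvec (hZ : ∀ v, Measurable (Z v)) (hf : HasPDF (fun ω v => Z v ω) P volume)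
    (A : Finset ι) : HasPDF (subvec Z A) P volume := by
  refine hasPDF_iff.2 ⟨(measurable_subvec hZ A).aemeasurable, inferInstance, ?_⟩
  have hq := quasiMeasurePreserving_restrict A
  have h : P.map (subvec Z A) =
      (P.map fun ω v => Z v ω).map fun (z : ι → ℝ) (a : A) => z a := by
    rw [Measure.map_map hq.measurable (measurable_pi_lambda _ hZ)]; rfl
  rw [h]
  exact (hf.absolutelyContinuous.map hq.measurable).trans hq.absolutelyContinuous

/-- Almost surely `Z_B` lies where its own density is nonzero. This is an almost sure property of
`Z_A`, hence holds Lebesgue-a.e. where the density of `Z_A` is nonzero. -/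
lemma density_pos_of_subset (hZ : ∀ v, Measurable (Z v)) (hf : HasPDF (fun ω v => Z v ω) P volume)
    {A B : Finset ι} (hBA : B ⊆ A) :
    ∀ᵐ z : ι → ℝ, 0 < density P Z A z → 0 < density P Z B z := by
  have := hasPDF_subvec hZ hf A
  have := hasPDF_subvec hZ hf B
  have hB : ∀ᵐ w ∂(P.map (subvec Z B)), pdf (subvec Z B) P volume w ≠ 0 := by
    rw [map_eq_withDensity_pdf (subvec Z B) P volume, ae_withDensity_iff (measurable_pdf _ _ _)]
    exact ae_of_all _ fun _ h => h
  let ρ : (A → ℝ) → (B → ℝ) := fun w b => w ⟨b, hBA b.2⟩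
  have hρ : Measurable ρ := measurable_pi_lambda _ fun b => measurable_pi_apply _
  have hmap : P.map (subvec Z B) = (P.map (subvec Z A)).map ρ := by
    rw [Measure.map_map hρ (measurable_subvec hZ A)]; rfl
  nth_rw 1 [hmap] at hB
  have hA := ae_of_ae_map hρ.aemeasurable hB
  rw [map_eq_withDensity_pdf (subvec Z A) P volume, ae_withDensity_iff (measurable_pdf _ _ _)] at hA
  have htop : ∀ᵐ w, pdf (subvec Z B) P volume w < ∞ := pdf.ae_lt_top
  filter_upwards [(quasiMeasurePreserving_restrict A).ae hA,
    (quasiMeasurePreserving_restrict B).ae htop] with z hz hz' hpos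
  have h0 : pdf (subvec Z A) P volume (fun a => z a) ≠ 0 := fun h => by
    simp [density, h] at hpos
  exact ENNReal.toReal_pos (hz h0) hz'.ne

lemma density_insert_insert_mul_density (hZ : ∀ v, Measurable (Z v))
    (hf : HasPDF (fun ω v => Z v ω) P volume) {x y : ι} {D : Finset ι} (hx : x ∉ D) (hy : y ∉ D)
    (hxy : x ≠ y) {c : ℝ × ℝ → ℝ} (hc : IsPairCopula P (pit P Z) x y D c) :
    ∀ᵐ z : ι → ℝ, 0 < density P Z D z →
      density P Z (insert y (insert x D)) z * density P Z D z =
        c (condDF P Z x D (z x) (fun d => z d), condDF P Z y D (z y) (fun d => z d)) *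
          (density P Z (insert x D) z * density P Z (insert y D) z) := by
  have := hasPDF_subvec hZ hf D
  have := hasPDF_subvec hZ hf (insert x D)
  have := hasPDF_subvec hZ hf (insert y D)
  have := hasPDF_subvec hZ hf (insert y (insert x D))
  have hatom : ∀ v, NullSingletonClass (P.map (Z v)) := fun v =>
    ⟨fun a => map_absolutelyContinuous hZ hf v (measure_singleton a)⟩
  have hy' : y ∉ insert x D := by simp [hxy.symm, hy]
  have hmain := joint_density_eq_of_sklar (measurable_subvec hZ D) (hZ x) (hZ y)
    (measurable_pdf (subvec Z D) P volume)
    ((measurable_pdf (subvec Z (insert x D)) P volume).comp (insertEquiv x D hx).symm.measurable)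
    ((measurable_pdf (subvec Z (insert y D)) P volume).comp (insertEquiv y D hy).symm.measurable)
    ((measurable_pdf (subvec Z (insert y (insert x D))) P volume).comp
      (insertEquiv₂ x y D hx hy').symm.measurable)
    (map_eq_withDensity_pdf (subvec Z D) P volume)
    (map_equiv_eq_withDensity (measurable_subvec hZ _)
      (map_eq_withDensity_pdf (subvec Z (insert x D)) P volume) _
      (volume_preserving_insertEquiv x D hx))
    (map_equiv_eq_withDensity (measurable_subvec hZ _)
      (map_eq_withDensity_pdf (subvec Z (insert y D)) P volume) _
      (volume_preserving_insertEquiv y D hy))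
    (map_equiv_eq_withDensity (measurable_subvec hZ _)
      (map_eq_withDensity_pdf (subvec Z (insert y (insert x D))) P volume) _
      (volume_preserving_insertEquiv₂ x y D hx hy'))
    hc.isCopulaDensity (hc.sklar_of_pit hZ hatom)
  filter_upwards [((volume_preserving_insertEquiv₂ x y D hx hy').quasiMeasurePreserving.comp
    (quasiMeasurePreserving_restrict (insert y (insert x D)))).ae hmain] with z hz hpos
  have hz0 := hz fun h => by
    have h' : pdf (subvec Z D) P volume (fun a => z a) = 0 := h
    simp [density, h'] at hpos
  have hz1 := congrArg ENNReal.toReal hz0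
  rw [ENNReal.toReal_mul, ENNReal.toReal_mul, ENNReal.toReal_mul,
    ENNReal.toReal_ofReal (hc.isCopulaDensity.nonneg _)] at hz1
  have e2 : (insertEquiv₂ x y D hx hy').symm
      (((insertEquiv₂ x y D hx hy') ∘ fun (z : ι → ℝ) a => z a) z) = fun a => z a.1 :=
    (insertEquiv₂ x y D hx hy').symm_apply_apply _
  have ex : (insertEquiv x D hx).symm (fun a => z a, z x) = fun a => z a.1 :=
    (insertEquiv x D hx).symm_apply_apply fun a => z a.1
  have ey : (insertEquiv y D hy).symm (fun a => z a, z y) = fun a => z a.1 :=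
    (insertEquiv y D hy).symm_apply_apply fun a => z a.1
  simp only [Function.comp_apply] at hz1 e2
  rw [e2] at hz1
  change _ * _ = _ * ((pdf (subvec Z (insert x D)) P volume
    ((insertEquiv x D hx).symm (fun a => z a, z x))).toReal *
      (pdf (subvec Z (insert y D)) P volume
        ((insertEquiv y D hy).symm (fun a => z a, z y))).toReal) at hz1
  rw [ex, ey] at hz1
  exact hz1

lemma density_singleton (hZ : ∀ v, Measurable (Z v)) (x : ι) :
    ∀ᵐ z : ι → ℝ, density P Z {x} z = (pdf (Z x) P volume (z x)).toReal := by
  have he : MeasurePreserving (MeasurableEquiv.funUnique ({x} : Finset ι) ℝ) := by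
    convert! volume_preserving_funUnique ({x} : Finset ι) ℝ
  have hmap : P.map (Z x) = (P.map (subvec Z {x})).map
      (MeasurableEquiv.funUnique ({x} : Finset ι) ℝ) := by
    rw [Measure.map_map (MeasurableEquiv.measurable _) (measurable_subvec hZ _)]; rfl
  have h := (MeasurableEquiv.funUnique ({x} : Finset ι) ℝ).measurableEmbedding.rnDeriv_map
    (P.map (subvec Z {x})) volume
  rw [he.map_eq, ← hmap] at h
  filter_upwards [(quasiMeasurePreserving_restrict {x}).ae h] with z hz
  exact (congrArg ENNReal.toReal hz).symm

end Densities

/-- Both the law and the volume are the unit mass on a one-point space, where an almost-everywhere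
equality holds at the point. This starts the telescoping. -/
lemma density_empty {Ω ι : Type*} [MeasurableSpace Ω] {P : Measure Ω} [IsProbabilityMeasure P]
    {Z : ι → Ω → ℝ} (hZ : ∀ v, Measurable (Z v)) (z : ι → ℝ) : density P Z ∅ z = 1 := by
  have hvol : (volume : Measure ((∅ : Finset ι) → ℝ)) = Measure.dirac default := by
    rw [volume_pi, Measure.pi_of_empty _ default]
  have hprob : IsProbabilityMeasure (P.map (subvec Z ∅)) :=
    Measure.isProbabilityMeasure_map (measurable_subvec hZ ∅).aemeasurable
  have h : P.map (subvec Z ∅) = volume := by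
    ext A
    rcases A.eq_empty_or_nonempty with rfl | hA
    · simp
    · rw [Subsingleton.eq_univ_of_nonempty hA, measure_univ, hvol, measure_univ]
  have h1 := Measure.rnDeriv_self (volume : Measure ((∅ : Finset ι) → ℝ))
  have : NeZero (volume : Measure ((∅ : Finset ι) → ℝ)) := ⟨by
    rw [hvol]; exact Measure.dirac_ne_zero⟩
  obtain ⟨w, hw⟩ := h1.exists
  rw [density, pdf_def, h, Subsingleton.elim (fun a : (∅ : Finset ι) => z a) w, hw]
  rfl

/-! ### Edges carrying the required labels -/

section Tree

variable {p : ℕ}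

lemma V_notMem_Us (j : Fin 2) (S : Finset (Fin p)) : (V j : YVar p) ∉ Us S := by simp [Us]

lemma U_mem_Us {i : Fin p} {S : Finset (Fin p)} : (U i : YVar p) ∈ Us S ↔ i ∈ S := by simp [Us]

lemma exists_isEdge_resp (j : Fin 2) (i : Fin p) :
    ∃ k a b, IsEdge p k a b ∧ IsEdgeLabel a b (V j) (U i) (Us (Finset.Iio i)) := by
  by_cases hi : i.val = 0
  · refine ⟨1, _, _, IsEdge.resp_first j i hi, ?_, ?_, ?_⟩
    · ext (a | a) <;> simp [Node.vars, varNode]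
    · ext (a | a) <;> simp [Node.vars, varNode]
    · ext (a | a)
      · simp [Node.vars, varNode, Us]
      · simp [Node.vars, varNode, Us, Fin.lt_def, hi]
  · have hp := i.isLt
    -- With predictors numbered from `0`, the edge joins `V_j U_{i-1}; U_{0:i-2}` to `U_0 U_i;
    -- U_{1:i-1}`: the nodes share `U_0, …, U_{i-1}`.
    refine ⟨i.val + 1, _, _, IsEdge.resp (i.val + 1) j ⟨0, by omega⟩ ⟨i.val - 1, by omega⟩ i rfl
      (by simp only; omega) rfl, ?_, ?_, ?_⟩
    all_goals
      ext (a | a)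
      · simp [Node.vars, respNode, predNode, Us]
      · simp [Node.vars, respNode, predNode, U_mem_Us, -Fin.val_fin_lt, Fin.lt_def, Fin.ext_iff]
        try omega

lemma exists_isEdge_last (hp : 1 ≤ p) :
    ∃ k a b, IsEdge p k a b ∧ IsEdgeLabel a b (V 0) (V 1) (Us (Finset.univ : Finset (Fin p))) := by
  refine ⟨p + 1, _, _, IsEdge.last ⟨p - 1, by omega⟩ (by simp only; omega), ?_, ?_, ?_⟩
  all_goals
    ext (a | a)
    · fin_cases a <;> simp [Node.vars, respNode, Us]
    · simp [Node.vars, respNode, U_mem_Us, -Fin.val_fin_lt, Fin.lt_def, Fin.ext_iff]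
      try omega

lemma Us_insert (i : Fin p) (S : Finset (Fin p)) : Us (insert i S) = insert (U i) (Us S) := by
  simp [Us, Finset.map_insert]

end Tree

/-! ### Telescoping along the vine -/

section Main

variable {Ω : Type*} [MeasurableSpace Ω] {P : Measure Ω} [IsProbabilityMeasure P] {p : ℕ}
  {Z : YVar p → Ω → ℝ} {c : YVar p → YVar p → Finset (YVar p) → ℝ × ℝ → ℝ}

/-- Conditioning on one more predictor multiplies the conditional density of a response by a pair
copula density. -/
lemma condDensity_resp_insert (hZ : ∀ v, Measurable (Z v))
    (hf : HasPDF (fun ω v => Z v ω) P volume) (hc : IsYVineCopula P (pit P Z) c)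
    (j : Fin 2) (i : Fin p) :
    ∀ᵐ z : YVar p → ℝ, 0 < density P Z (insert (U i) (Us (Finset.Iio i))) z →
      condDensity P Z (V j) (insert (U i) (Us (Finset.Iio i))) z =
        c (V j) (U i) (Us (Finset.Iio i))
          (condDF P Z (V j) (Us (Finset.Iio i)) (z (V j)) (fun d => z d),
            condDF P Z (U i) (Us (Finset.Iio i)) (z (U i)) (fun d => z d)) *
        condDensity P Z (V j) (Us (Finset.Iio i)) z := by
  obtain ⟨k, a, b, he, hl⟩ := exists_isEdge_resp j i
  filter_upwards [density_insert_insert_mul_density hZ hf (V_notMem_Us j _)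
    (by simp [U_mem_Us]) (by simp) (hc.pairCopula k a b he _ _ _ hl),
    density_pos_of_subset hZ hf (Finset.subset_insert (U i) (Us (Finset.Iio i)))]
    with z hz hpos h0
  have h1 := hpos h0
  have hz := hz h1
  rw [condDensity, condDensity, Finset.insert_comm, div_eq_iff h0.ne', mul_assoc, mul_comm_div,
    ← mul_div_assoc, ← mul_div_assoc, eq_div_iff h1.ne', hz]

lemma condDensity_resp (hZ : ∀ v, Measurable (Z v)) (hf : HasPDF (fun ω v => Z v ω) P volume)
    (hc : IsYVineCopula P (pit P Z) c) (j : Fin 2) :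
    ∀ᵐ z : YVar p → ℝ, 0 < density P Z (Us Finset.univ) z →
      condDensity P Z (V j) (Us Finset.univ) z =
        (pdf (Z (V j)) P volume (z (V j))).toReal *
        ∏ i : Fin p, c (V j) (U i) (Us (Finset.Iio i))
          (condDF P Z (V j) (Us (Finset.Iio i)) (z (V j)) (fun d => z d),
            condDF P Z (U i) (Us (Finset.Iio i)) (z (U i)) (fun d => z d)) := by
  -- The induction is on the number `n` of predictors conditioned on; `S n` is meaningful also at `n
  -- = p`, where no `Finset.Iio i` is available.
  let S : ℕ → Finset (Fin p) := fun n => Finset.univ.filter fun i => i.val < n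
  have hS : ∀ i : Fin p, S i = Finset.Iio i := fun i => by ext a; simp [S]
  have hS' : ∀ i : Fin p, S (i.val + 1) = insert i (Finset.Iio i) := fun i => by
    ext a; simp [S, le_iff_eq_or_lt, Fin.ext_iff]
  have hSp : S p = Finset.univ := by ext a; simp [S]
  suffices h : ∀ n ≤ p, ∀ᵐ z : YVar p → ℝ, 0 < density P Z (Us (S n)) z →
      condDensity P Z (V j) (Us (S n)) z =
        (pdf (Z (V j)) P volume (z (V j))).toReal *
        ∏ i ∈ S n, c (V j) (U i) (Us (Finset.Iio i))
          (condDF P Z (V j) (Us (Finset.Iio i)) (z (V j)) (fun d => z d),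
            condDF P Z (U i) (Us (Finset.Iio i)) (z (U i)) (fun d => z d)) by
    have := h p le_rfl
    rwa [hSp] at this
  intro n
  induction n with
  | zero =>
    intro _
    have h0 : S 0 = ∅ := by simp [S]
    filter_upwards [density_singleton (P := P) hZ (V j)] with z hz _
    have h1 : Us (∅ : Finset (Fin p)) = ∅ := rfl
    rw [h0, h1, condDensity, density_empty hZ, insert_empty_eq, hz]
    simp
  | succ n ih =>
    intro hn
    have hi := hS' ⟨n, hn⟩
    have hi0 := hS ⟨n, hn⟩
    simp only at hi hi0
    have ih := ih (Nat.le_of_succ_le hn)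
    rw [hi0] at ih
    rw [hi, Us_insert]
    filter_upwards [ih, condDensity_resp_insert hZ hf hc j ⟨n, hn⟩,
      density_pos_of_subset hZ hf (Finset.subset_insert (U ⟨n, hn⟩) (Us (Finset.Iio ⟨n, hn⟩)))]
      with z ih hz hpos h0
    rw [hz h0, ih (hpos h0), Finset.prod_insert (by simp)]
    ring

lemma density_resp_resp (hZ : ∀ v, Measurable (Z v)) (hf : HasPDF (fun ω v => Z v ω) P volume)
    (hc : IsYVineCopula P (pit P Z) c) (hp : 1 ≤ p) {j k : Fin 2} (hjk : j ≠ k) :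
    ∀ᵐ z : YVar p → ℝ, 0 < density P Z (insert (V j) (Us Finset.univ)) z →
      condDensity P Z (V k) (insert (V j) (Us Finset.univ)) z =
        condDensity P Z (V k) (Us Finset.univ) z *
        c (V 0) (V 1) (Us Finset.univ)
          (condDF P Z (V 0) (Us Finset.univ) (z (V 0)) (fun d => z d),
            condDF P Z (V 1) (Us Finset.univ) (z (V 1)) (fun d => z d)) := by
  obtain ⟨l, a, b, he, hl⟩ := exists_isEdge_last hp
  filter_upwards [density_insert_insert_mul_density hZ hf (V_notMem_Us 0 _) (V_notMem_Us 1 _)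
    (by simp) (hc.pairCopula l a b he _ _ _ hl),
    density_pos_of_subset hZ hf (Finset.subset_insert (V j) (Us Finset.univ))] with z hz hpos h0
  have h1 := hpos h0
  have hz := hz h1
  rw [condDensity, condDensity, div_eq_iff h0.ne', div_mul_eq_mul_div, div_mul_eq_mul_div,
    eq_div_iff h1.ne']
  -- The pair copula is indexed by the ordered pair `(V 0, V 1)`, but the full joint density is
  -- symmetric, so one identity serves both cases.
  obtain ⟨rfl, rfl⟩ | ⟨rfl, rfl⟩ : (j = 0 ∧ k = 1) ∨ (j = 1 ∧ k = 0) := by omega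
  · rw [hz]; ring
  · rw [Finset.insert_comm, hz]; ring

end Main

end YVine

theorem corollary1 {Ω : Type*} [MeasurableSpace Ω] (P : Measure Ω) [IsProbabilityMeasure P]
    (p : ℕ) (hp : 1 ≤ p)
    -- the responses and the predictors, with a joint density
    (Y : Fin 2 → Ω → ℝ) (X : Fin p → Ω → ℝ)
    (hY : ∀ j, Measurable (Y j)) (hX : ∀ i, Measurable (X i))
    (hf : HasPDF (fun ω v => YVine.joint Y X v ω) P volume)
    -- the pair copula densities `c x y D = c_{x, y; D}` of the Y-vine
    (c : YVine.YVar p → YVine.YVar p → Finset (YVine.YVar p) → ℝ × ℝ → ℝ)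
    -- the probability integral transforms follow the Y-vine copula
    (hc : YVine.IsYVineCopula P (YVine.pit P (YVine.joint Y X)) c) :
    -- a. the conditional density of `Y_j` given `X`
    (∀ j : Fin 2, ∀ᵐ z : YVine.YVar p → ℝ,
      0 < YVine.density P (YVine.joint Y X) (YVine.Us Finset.univ) z →
      YVine.condDensity P (YVine.joint Y X) (YVine.V j) (YVine.Us Finset.univ) z =
        (pdf (Y j) P volume (z (YVine.V j))).toReal *
        ∏ i : Fin p, c (YVine.V j) (YVine.U i) (YVine.Us (Finset.Iio i))
          (YVine.condDF P (YVine.joint Y X) (YVine.V j) (YVine.Us (Finset.Iio i))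
              (z (YVine.V j)) (fun d => z d),
           YVine.condDF P (YVine.joint Y X) (YVine.U i) (YVine.Us (Finset.Iio i))
              (z (YVine.U i)) (fun d => z d))) ∧
    -- b. the conditional density of `Y_k` given `X` and `Y_j`
    (∀ j k : Fin 2, j ≠ k → ∀ᵐ z : YVine.YVar p → ℝ,
      0 < YVine.density P (YVine.joint Y X)
          (insert (YVine.V j) (YVine.Us Finset.univ)) z →
      YVine.condDensity P (YVine.joint Y X) (YVine.V k)
          (insert (YVine.V j) (YVine.Us Finset.univ)) z =
        (∏ i : Fin p, c (YVine.V k) (YVine.U i) (YVine.Us (Finset.Iio i))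
          (YVine.condDF P (YVine.joint Y X) (YVine.V k) (YVine.Us (Finset.Iio i))
              (z (YVine.V k)) (fun d => z d),
           YVine.condDF P (YVine.joint Y X) (YVine.U i) (YVine.Us (Finset.Iio i))
              (z (YVine.U i)) (fun d => z d))) *
        c (YVine.V 0) (YVine.V 1) (YVine.Us Finset.univ)
          (YVine.condDF P (YVine.joint Y X) (YVine.V 0) (YVine.Us Finset.univ)
              (z (YVine.V 0)) (fun d => z d),
           YVine.condDF P (YVine.joint Y X) (YVine.V 1) (YVine.Us Finset.univ)
              (z (YVine.V 1)) (fun d => z d)) *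
        (pdf (Y k) P volume (z (YVine.V k))).toReal) := by
  have hZ : ∀ v, Measurable (YVine.joint Y X v) := by
    rintro (j | i)
    · exact hY j
    · exact hX i
  refine ⟨fun j => YVine.condDensity_resp hZ hf hc j, fun j k hjk => ?_⟩
  filter_upwards [YVine.condDensity_resp hZ hf hc k, YVine.density_resp_resp hZ hf hc hp hjk,
    YVine.density_pos_of_subset hZ hf
      (Finset.subset_insert (YVine.V j) (YVine.Us Finset.univ))] with z h1 h2 hpos h0
  rw [h2 h0, h1 (hpos h0), mul_assoc]
  exact mul_comm _ _
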